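/- Consider $\dot x=f(x,u)$, $x\in\mathbb R^n$, with controls $u$ in a compact set $\mathbb U$. For each closed ball $B\subset\mathbb R^n$ let there be $K>0$ with $\|f(x,u)-f(y,u)\|\le K\|x-y\|$ for all $x,y\in B$, $u\in\mathbb U$. Write $\mathcal B_\rho(x)$ for the closed Euclidean ball, $\mathcal B_\rho=\mathcal B_\rho(0)$, and $\mathcal D_\theta L(x)=\liminf_{\mu\to0^+}\frac{L(x+\mu\theta)-L(x)}{\mu}$. Let $L:\mathbb R^n\to\mathbb R$ be a control Lyapunov function: $L$ is proper, positive definite and locally Lipschitz, $\alpha_1(\|x\|)\le L(x)\le\alpha_2(\|x\|)$ for some $\alpha_1,\alpha_2\in\mathcal K_\infty$, and there is a continuous $w:\mathbb R^n\to[0,\infty)$, positive outside the origin, such that for each compact $\mathbb X\subset\mathbb R^n$ there is a compact $\mathbb U(\mathbb X)\subseteq\mathbb U$ with $$\inf_{\theta\in\overline{\mathrm{co}}\,f(x,\mathbb U(\mathbb X))}\mathcal D_\theta L(x)\le -w(x)\qquad\text{for all }x\in\mathbb X .$$ A Dini-aiming feedback of radius $r>0$ is a map $\kappa:\mathbb R^n\to\mathbb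 U$ such that for every $x$ there is $z^\star\in\arg\min_{\partial\mathcal B_r(x)}L$ with $\kappa(x)\in\arg\min_{u\in\mathbb U}\langle f(x,u),x-z^\star\rangle$. In the sample-and-hold mode with period $\delta>0$ the control on $[k\delta,(k+1)\delta)$ is the constant $\kappa(x(k\delta))$, $k=0,1,2,\dots$ Let $0<s<S$. Put $S^\star=\alpha_1^{-1}(\sup_{\mathcal B_S}L)$, $\hat L^\star=\sup_{\mathcal B_{S^\star}}L$, $\hat\ell=\alpha_1(s)$, $s^\star=\alpha_2^{-1}(\hat\ell/4)$, and let $R>S^\star$. Let $\mathrm{Lip}_L>0$ be a Lipschitz constant of $L$ on $\mathcal B_R$, $\mathrm{Lip}_f>0$ a Lipschitz constant of $f(\cdot,u)$ on $\mathcal B_R$ for all $u\in\mathbb U$, $\tilde M$ a bound of $\|f\|$ on $\mathcal B_R\times\mathbb U$, and $c>0$ a minimal decay, i.e. $c\le w(x)$ whenever $s^\star/2\le\|x\|\le R$. Then there are positive numbers $\varepsilon_2,\varepsilon_3,\varepsilon_4$ and $0<\ell_1<\ell_2$, depending only on the data introduced so far (not on $r$, $\delta$, the choice of $\kappa$, or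 the initial state), such that the following holds with $$\bar r=\min\Big\{\tfrac{\varepsilon_2}{\mathrm{Lip}_L},\varepsilon_3,\varepsilon_4,\tfrac{c}{\mathrm{Lip}_f\mathrm{Lip}_L}\Big\},\qquad \bar\delta=\min\Big\{T_1,\tfrac{\ell_2-\ell_1}{\mathrm{Lip}_LM},\tfrac{\varepsilon_3}{M},\tfrac{\sqrt{a_2^2+4a_1a_3}-a_2}{2a_1}\Big\},$$ where $M=\tilde M+\frac{c}{2\mathrm{Lip}_L}$, $a_1=M^2\mathrm{Lip}_L$, $a_2=M(M+r\,\mathrm{Lip}_f)$, $a_3=\frac{cr}{4\mathrm{Lip}_L}$, and $T_1>0$ is any number for which $\frac{cT_1}{16\mathrm{Lip}_L}\le r-\sqrt{r^2-\frac{rcT_1}{4\mathrm{Lip}_L}}$ (with nonnegative radicand). For every $0<r\le\bar r$, every $0<\delta\le\bar\delta$ and every Dini-aiming feedback $\kappa$ of radius $r$, the sample-and-hold closed loop practically stabilizes the origin: from each $x_0\in\mathcal B_S$ there is a closed-loop trajectory on $[0,\infty)$, and each such trajectory satisfies $x(t)\in\mathcal B_R$ for all $t\ge0$ and $x(t)\in\mathcal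 B_s$ for all $t\ge T$, with the reaching time $T=\delta\cdot\frac{4(\hat L^\star-\hat\ell/2)}{\delta c}$, i.e. after $\frac{4(\hat L^\star-\hat\ell/2)}{\delta c}$ sampling periods. -/

import Mathlib

open Set Filter Topology Metric

/-- The state space `ℝⁿ` with the Euclidean norm. -/
abbrev State (n : ℕ) : Type := EuclideanSpace ℝ (Fin n)

/-- Functions of class `𝒦_∞`: continuous, strictly increasing and unbounded on `[0, ∞)`,
with value `0` at `0`. -/
structure IsKInfty (α : ℝ → ℝ) : Prop where
  continuousOn : ContinuousOn α (Ici 0)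
  strictMonoOn : StrictMonoOn α (Ici 0)
  map_zero : α 0 = 0
  tendsto_atTop : Tendsto α atTop atTop

/-- The inverse `α⁻¹ : [0, ∞) → [0, ∞)` of a function of class `𝒦_∞`. -/
noncomputable def kInv (α : ℝ → ℝ) (y : ℝ) : ℝ := Function.invFunOn α (Ici 0) y

/-- The lower directional generalized (Dini) derivative
`𝒟_θ L(x) = liminf_{μ → 0⁺} (L(x + μ θ) - L(x)) / μ`, as an extended real number. -/
noncomputable def lowerDini {n : ℕ} (L : State n → ℝ) (x θ : State n) : EReal :=
  liminf (fun μ : ℝ => (((L (x + μ • θ) - L x) / μ : ℝ) : EReal)) (𝓝[>] (0 : ℝ))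

/-- The right-hand side `f` is Lipschitz in the state on every closed ball, uniformly over the
admissible controls. -/
def LipschitzInState {n : ℕ} {C : Type*} (f : State n → C → State n) (U : Set C) : Prop :=
  ∀ z : State n, ∀ ω : ℝ, 0 < ω → ∃ K : ℝ, 0 < K ∧
    ∀ x ∈ closedBall z ω, ∀ y ∈ closedBall z ω, ∀ u ∈ U, ‖f x u - f y u‖ ≤ K * ‖x - y‖

/-- `L` is a (possibly nonsmooth) control Lyapunov function for `ẋ = f(x, u)`, `u ∈ U`, with decay
rate `w` and `𝒦_∞` bounds `α₁`, `α₂`. -/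
structure IsCLF {n : ℕ} {C : Type*} [TopologicalSpace C] (f : State n → C → State n) (U : Set C)
    (L w : State n → ℝ) (α₁ α₂ : ℝ → ℝ) : Prop where
  proper : Tendsto L (cocompact (State n)) atTop
  map_zero : L 0 = 0
  pos : ∀ x, x ≠ 0 → 0 < L x
  locallyLipschitz : LocallyLipschitz L
  lower_kInfty : IsKInfty α₁
  upper_kInfty : IsKInfty α₂
  lower_bound : ∀ x, α₁ ‖x‖ ≤ L x
  upper_bound : ∀ x, L x ≤ α₂ ‖x‖
  rate_continuous : Continuous w
  rate_nonneg : ∀ x, 0 ≤ w x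
  rate_pos : ∀ x, x ≠ 0 → 0 < w x
  decay : ∀ X : Set (State n), IsCompact X → ∃ V : Set C, V ⊆ U ∧ IsCompact V ∧
    ∀ x ∈ X, (⨅ θ ∈ closure (convexHull ℝ (f x '' V)), lowerDini L x θ) ≤ ((-w x : ℝ) : EReal)

/-- `κ` is a Dini-aiming feedback of radius `r`: at every state `x`, for some minimizer `z` of `L`
over the sphere of radius `r` around `x`, the value `κ x` minimizes `⟨f(x, u), x - z⟩` over
`u ∈ U`. -/
def IsDiniAiming {n : ℕ} {C : Type*} (f : State n → C → State n) (U : Set C)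
    (L : State n → ℝ) (r : ℝ) (κ : State n → C) : Prop :=
  ∀ x, ∃ z ∈ sphere x r, IsMinOn L (sphere x r) z ∧
    κ x ∈ U ∧ IsMinOn (fun u => inner ℝ (f x u) (x - z)) U (κ x)

/-- `x : [0, ∞) → ℝⁿ` is a closed-loop trajectory from `x₀` of `ẋ = f(x, κ(x))` in the
sample-and-hold mode with sampling period `δ`: the control `κ(x(kδ))` is held constant on
`[kδ, (k+1)δ)`. Values of `x` at negative times play no role. -/
structure IsSampleHoldTrajectory {n : ℕ} {C : Type*} (f : State n → C → State n)
    (κ : State n → C) (δ : ℝ) (x₀ : State n) (x : ℝ → State n) : Prop where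
  init : x 0 = x₀
  continuousOn : ContinuousOn x (Ici 0)
  deriv : ∀ k : ℕ, ∀ t ∈ Ico (k * δ) ((k + 1) * δ),
    HasDerivWithinAt x (f (x t) (κ (x (k * δ)))) (Ico (k * δ) ((k + 1) * δ)) t

/-- The largest value of `L` on the closed ball of radius `ρ` around the origin. -/
noncomputable def maxOnBall {n : ℕ} (L : State n → ℝ) (ρ : ℝ) : ℝ :=
  sSup (L '' closedBall (0 : State n) ρ)

/-- The overshoot bound `S^⋆ = α₁⁻¹(sup_{‖x‖ ≤ S} L(x))`. -/
noncomputable def overshootRadius {n : ℕ} (L : State n → ℝ) (α₁ : ℝ → ℝ) (S : ℝ) : ℝ :=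
  kInv α₁ (maxOnBall L S)

/-- The radius `s^⋆ = α₂⁻¹(α₁(s) / 4)` of the core ball. -/
noncomputable def coreRadius (α₁ α₂ : ℝ → ℝ) (s : ℝ) : ℝ := kInv α₂ (α₁ s / 4)

/-- The numbers from which the bounds on the aiming radius and on the sampling period are computed,
on the ball of radius `R`: a Lipschitz constant `KL` of `L`, a Lipschitz constant `Kf` of `f` in the
state, a bound `Mf` of the dynamics, and a minimal decay `c`, that is, a positive lower bound of the
decay rate `w` outside the ball of radius `ρ`. -/
structure AreConstantsOn {n : ℕ} {C : Type*} (f : State n → C → State n) (U : Set C)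
    (L w : State n → ℝ) (ρ R KL Kf Mf c : ℝ) : Prop where
  KL_pos : 0 < KL
  Kf_pos : 0 < Kf
  c_pos : 0 < c
  lipschitz_L : ∀ x ∈ closedBall (0 : State n) R, ∀ y ∈ closedBall (0 : State n) R,
    |L x - L y| ≤ KL * ‖x - y‖
  lipschitz_f : ∀ x ∈ closedBall (0 : State n) R, ∀ y ∈ closedBall (0 : State n) R, ∀ u ∈ U,
    ‖f x u - f y u‖ ≤ Kf * ‖x - y‖
  bound_f : ∀ x ∈ closedBall (0 : State n) R, ∀ u ∈ U, ‖f x u‖ ≤ Mf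
  decay_le : ∀ x : State n, ρ ≤ ‖x‖ → ‖x‖ ≤ R → c ≤ w x

/-- The bound `r̄ = min {ε₂ / KL, ε₃, ε₄, c / (Kf KL)}` on the aiming radius. -/
noncomputable def radiusBound (KL Kf c ε₂ ε₃ ε₄ : ℝ) : ℝ :=
  min (min (ε₂ / KL) ε₃) (min ε₄ (c / (Kf * KL)))

/-- The condition on the number `T₁` that enters the bound on the sampling period:
`c T₁ / (16 KL) ≤ r - √(r² - r c T₁ / (4 KL))`, with a nonnegative radicand. -/
def IsAdmissibleTime (r KL c T₁ : ℝ) : Prop :=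
  0 < T₁ ∧ 0 ≤ r ^ 2 - r * c * T₁ / (4 * KL) ∧
    c * T₁ / (16 * KL) ≤ r - Real.sqrt (r ^ 2 - r * c * T₁ / (4 * KL))

/-- The bound `δ̄ = min {T₁, (ℓ₂ - ℓ₁) / (KL M), ε₃ / M, (√(a₂² + 4 a₁ a₃) - a₂) / (2 a₁)}` on the
sampling period, with `M = Mf + c / (2 KL)`, `a₁ = M² KL`, `a₂ = M (M + r Kf)` and
`a₃ = c r / (4 KL)`. -/
noncomputable def periodBound (r KL Kf Mf c T₁ l₁ l₂ ε₃ : ℝ) : ℝ :=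
  let M : ℝ := Mf + c / (2 * KL)
  let a₁ : ℝ := M ^ 2 * KL
  let a₂ : ℝ := M * (M + r * Kf)
  let a₃ : ℝ := c * r / (4 * KL)
  min (min T₁ ((l₂ - l₁) / (KL * M)))
    (min (ε₃ / M) ((Real.sqrt (a₂ ^ 2 + 4 * a₁ * a₃) - a₂) / (2 * a₁)))

/-- The reaching time: `4 (L̂^⋆ - α₁(s)/2) / (δ c)` sampling periods of length `δ`, with `L̂^⋆` the
largest value of `L` on the ball of radius `S^⋆`. -/
noncomputable def reachingTime {n : ℕ} (L : State n → ℝ) (α₁ : ℝ → ℝ) (s S c δ : ℝ) : ℝ :=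
  δ * (4 * (maxOnBall L (overshootRadius L α₁ S) - α₁ s / 2) / (δ * c))

/-- In the sample-and-hold mode with period `δ`, the feedback `κ` steers every initial state of the
ball of radius `S` into the ball of radius `s`: closed-loop trajectories exist for all times, and
each of them stays in the ball of radius `R` and lies in the ball of radius `s` from time `T` on. -/
def SteersBallToBall {n : ℕ} {C : Type*} (f : State n → C → State n) (κ : State n → C)
    (δ S s R T : ℝ) : Prop :=
  ∀ x₀ ∈ closedBall (0 : State n) S,
    (∃ x : ℝ → State n, IsSampleHoldTrajectory f κ δ x₀ x) ∧
    ∀ x : ℝ → State n, IsSampleHoldTrajectory f κ δ x₀ x →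
      (∀ t, 0 ≤ t → x t ∈ closedBall (0 : State n) R) ∧
      (∀ t, T ≤ t → x t ∈ closedBall (0 : State n) s)

/-! The quantity that decreases along the sampled motion is not `L` at the state but V(x), the least
value of `L` over the closed ball of radius r around x. Let z attain V(x) and p = x - z. Aiming
makes ⟨F, p⟩ minimal for the applied velocity F. By linearity and the Lipschitz bound on `f`, ⟨F, p⟩
≤ ⟨θ, p⟩ + O(r(r + Mδ)) for every θ in the closed convex hull of the velocities available near z. So
if z moves along a descent direction θ while x moves along F, their distance exceeds r only slightly
after time δ, and pulling the moved z back into the new ball costs less than it gained. This is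
`exists_mem_closedBall_le_of_aiming`; the finite step from z is `exists_decrease_of_lowerDini_lt`.

The feedback aims at a minimizer over the sphere only, but decay excludes interior minimizers, so it
also minimizes over the ball. Where decay is not guaranteed, `L` is already so small that it stays
below ℓ/2 for a period, with ℓ = `α₁ s`. Hence V drops by cδ/4 per period or is at most ℓ/2
(`IsDiniAiming.exists_mem_closedBall_le`). By induction the state remains close to a sublevel set of
`L`, hence in the ball of radius R, and L(x(t)) exceeds the bound on V by at most 2·KL·ε. -/

theorem IsKInfty.exists_eq {α : ℝ → ℝ} (h : IsKInfty α) {y : ℝ} (hy : 0 ≤ y) :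
    ∃ a ∈ Ici (0 : ℝ), α a = y := by
  obtain ⟨b, hb, hb0⟩ := ((h.tendsto_atTop.eventually_ge_atTop y).and (eventually_ge_atTop 0)).exists
  obtain ⟨a, ha, hay⟩ := intermediate_value_Icc hb0 (h.continuousOn.mono Icc_subset_Ici_self)
    ⟨h.map_zero.le.trans hy, hb⟩
  exact ⟨a, ha.1, hay⟩

theorem IsKInfty.kInv_nonneg {α : ℝ → ℝ} (h : IsKInfty α) {y : ℝ} (hy : 0 ≤ y) : 0 ≤ kInv α y :=
  Function.invFunOn_mem (h.exists_eq hy)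

theorem IsKInfty.map_kInv {α : ℝ → ℝ} (h : IsKInfty α) {y : ℝ} (hy : 0 ≤ y) :
    α (kInv α y) = y :=
  Function.invFunOn_eq (h.exists_eq hy)

theorem IsKInfty.pos {α : ℝ → ℝ} (h : IsKInfty α) {a : ℝ} (ha : 0 < a) : 0 < α a := by
  simpa [h.map_zero] using h.strictMonoOn self_mem_Ici ha.le ha

theorem IsKInfty.le_of_map_le {α : ℝ → ℝ} (h : IsKInfty α) {a b : ℝ} (ha : 0 ≤ a) (hb : 0 ≤ b)
    (hab : α a ≤ α b) : a ≤ b :=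
  (h.strictMonoOn.le_iff_le ha hb).1 hab

/-! ### Dini derivatives and the aiming step. -/

section Dini

variable {n : ℕ} {L : State n → ℝ} {x y z θ : State n}

theorem IsLocalMin.lowerDini_nonneg (h : IsLocalMin L y) (θ : State n) : 0 ≤ lowerDini L y θ := by
  have hc : Tendsto (fun μ : ℝ => y + μ • θ) (𝓝[>] 0) (𝓝 y) := by
    have : Continuous fun μ : ℝ => y + μ • θ := by fun_prop
    simpa using (this.tendsto 0).mono_left nhdsWithin_le_nhds
  refine le_liminf_of_le (by isBoundedDefault) ?_
  filter_upwards [hc.eventually h, self_mem_nhdsWithin] with μ hμ hpos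
  exact_mod_cast div_nonneg (sub_nonneg.2 hμ) (le_of_lt hpos)

/-- If the Lyapunov function has a direction of decrease at each of its minimizers over a closed
ball, then its minimizers over the sphere are minimizers over the ball. -/
theorem isMinOn_closedBall_of_isMinOn_sphere (hL : Continuous L) {r : ℝ} (hr : 0 ≤ r)
    (hz : IsMinOn L (sphere x r) z)
    (h : ∀ y ∈ closedBall x r, IsMinOn L (closedBall x r) y → ∃ θ, lowerDini L y θ < 0) :
    IsMinOn L (closedBall x r) z := by
  obtain ⟨y, hy, hmin⟩ := (isCompact_closedBall x r).exists_isMinOn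
    (nonempty_closedBall.2 hr) hL.continuousOn
  have hys : y ∈ sphere x r := by
    by_contra hne
    have hlt : y ∈ ball x r := lt_of_le_of_ne hy hne
    obtain ⟨θ, hθ⟩ := h y hy hmin
    exact not_le.2 hθ ((hmin.isLocalMin
      (mem_of_superset (isOpen_ball.mem_nhds hlt) ball_subset_closedBall)).lowerDini_nonneg θ)
  exact fun v hv => show L z ≤ L v from le_trans (hz hys) (hmin hv)

/-- Infinitesimal decrease along directions taken from a fixed compact convex set integrates to
a decrease over a step of finite length. -/
theorem exists_decrease_of_lowerDini_lt (hL : Continuous L) {D : Set (State n)}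
    (hD : Convex ℝ D) (hDcl : IsClosed D) {M τ c : ℝ} (hM0 : 0 ≤ M) (hM : ∀ θ ∈ D, ‖θ‖ ≤ M)
    (hτ : 0 ≤ τ)
    (h : ∀ y ∈ closedBall z (M * τ), ∃ θ ∈ D, lowerDini L y θ < ((-c : ℝ) : EReal)) :
    ∃ θ ∈ D, L (z + τ • θ) ≤ L z - c * τ := by
  have hDcomp : IsCompact D := isCompact_of_isClosed_isBounded hDcl
    (isBounded_iff_forall_norm_le.2 ⟨M, hM⟩)
  -- A compact set of times and constant directions with the required decrease. Its largest time is
  -- shown to be τ.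
  set A : Set (ℝ × State n) := (Icc 0 τ ×ˢ D) ∩ {q | L (z + q.1 • q.2) ≤ L z - c * q.1} with hA
  have hAc : IsCompact A :=
    (isCompact_Icc.prod hDcomp).inter_right (isClosed_le (by fun_prop) (by fun_prop))
  obtain ⟨θ₀, hθ₀, -⟩ := h z (mem_closedBall_self (mul_nonneg hM0 hτ))
  have hne : A.Nonempty := ⟨(0, θ₀), ⟨⟨⟨le_rfl, hτ⟩, hθ₀⟩, by simp⟩⟩
  obtain ⟨⟨t, θ⟩, ⟨⟨⟨ht0, htτ⟩, hθ⟩, hLt⟩, hmax⟩ :=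
    hAc.exists_isMaxOn hne (f := Prod.fst) continuous_fst.continuousOn
  simp only at ht0 htτ hθ
  simp only [mem_ofPred_eq] at hLt
  rcases htτ.eq_or_lt with rfl | hlt
  · exact ⟨θ, hθ, hLt⟩
  exfalso
  obtain ⟨θ', hθ', hdini⟩ := h (z + t • θ) (by
    rw [mem_closedBall, dist_eq_norm, add_sub_cancel_left, norm_smul, Real.norm_of_nonneg ht0,
      mul_comm]
    exact mul_le_mul (hM _ hθ) htτ ht0 hM0)
  have hfr := frequently_lt_of_liminf_lt (by isBoundedDefault) hdini
  have hev : ∀ᶠ μ in 𝓝[>] (0 : ℝ), μ ∈ Ioo 0 (τ - t) := Ioo_mem_nhdsGT (sub_pos.2 hlt)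
  obtain ⟨μ, hμ, hμ0, hμτ⟩ := (hfr.and_eventually hev).exists
  have hμ' : (L (z + t • θ + μ • θ') - L (z + t • θ)) / μ < -c := by exact_mod_cast hμ
  rw [div_lt_iff₀ hμ0] at hμ'
  have hs : 0 < t + μ := by linarith
  -- By convexity, θ for time t followed by θ' for time μ amounts to one direction of `D` for time t
  -- + μ.
  have hmem : (t / (t + μ)) • θ + (μ / (t + μ)) • θ' ∈ D :=
    hD hθ hθ' (by positivity) (by positivity) (by field_simp)
  have heq : (t + μ) • ((t / (t + μ)) • θ + (μ / (t + μ)) • θ') = t • θ + μ • θ' := by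
    rw [smul_add, smul_smul, smul_smul, mul_div_cancel₀ _ hs.ne', mul_div_cancel₀ _ hs.ne']
  have hin : ((t + μ, (t / (t + μ)) • θ + (μ / (t + μ)) • θ') : ℝ × State n) ∈ A := by
    refine ⟨⟨⟨hs.le, by simp only; linarith⟩, hmem⟩, ?_⟩
    simp only [mem_ofPred_eq]
    rw [heq, ← add_assoc]
    linarith
  have := hmax hin
  simp only [mem_ofPred_eq] at this
  linarith

end Dini

/-- One step of Dini aiming: if `z` minimizes `L` over the ball of radius `r` around `x`, and `x'` is
close to the Euler step from `x` with the aiming control, then the least value of `L` over the ball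
around `x'` is smaller by `c δ / 4` than `L z`. -/
theorem exists_mem_closedBall_le_of_aiming {n : ℕ} {C : Type*} {f : State n → C → State n}
    {U : Set C} {L : State n → ℝ} (hL : Continuous L) {x z x' : State n} {u : C}
    {r δ M KL Kf c : ℝ} (hr : 0 < r) (hδ : 0 < δ) (hM : 0 ≤ M) (hKL : 0 < KL) (hKf : 0 < Kf)
    (hlipL : ∀ a ∈ closedBall x (r + M * δ), ∀ b ∈ closedBall x (r + M * δ),
      |L a - L b| ≤ KL * ‖a - b‖)
    (hlipf : ∀ a ∈ closedBall x (r + M * δ), ∀ b ∈ closedBall x (r + M * δ), ∀ v ∈ U,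
      ‖f a v - f b v‖ ≤ Kf * ‖a - b‖)
    (hbound : ∀ a ∈ closedBall x (r + M * δ), ∀ v ∈ U, ‖f a v‖ ≤ M)
    (hdecay : ∀ a ∈ closedBall x (r + M * δ), ∃ V ⊆ U, ∃ θ ∈ closure (convexHull ℝ (f a '' V)),
      lowerDini L a θ < ((-(7 / 8 * c) : ℝ) : EReal))
    (hz : z ∈ sphere x r) (hu : u ∈ U)
    (humin : IsMinOn (fun v => inner ℝ (f x v) (x - z)) U u)
    (hx' : ‖x' - x‖ ≤ M * δ) (hEuler : ‖x' - x - δ • f x u‖ ≤ Kf * (M * δ) * δ)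
    (hsmall : M ^ 2 * δ ≤ c * r / (4 * KL)) (hsmall' : KL * Kf * (r + 2 * (M * δ)) ≤ c / 8) :
    ∃ y ∈ closedBall x' r, L y ≤ L z - c * δ / 4 := by
  set p := x - z with hp
  have hpr : ‖p‖ = r := by rw [hp, norm_sub_rev, ← dist_eq_norm]; exact hz
  have hMδ : 0 ≤ M * δ := by positivity
  have hxmem : x ∈ closedBall x (r + M * δ) := mem_closedBall_self (by positivity)
  -- The half-space ⟨θ, p⟩ ≥ m is relaxed by the variation of `f` over the large ball, so that one
  -- convex set `D` holds the velocities at all its points.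
  set m := inner ℝ (f x u) p - Kf * (r + M * δ) * r with hm
  set D : Set (State n) := closedBall 0 M ∩ {θ | m ≤ inner ℝ θ p} with hDdef
  have hDcl : IsClosed D :=
    isClosed_closedBall.inter (isClosed_le continuous_const (by fun_prop))
  have hDconv : Convex ℝ D := by
    refine (convex_closedBall _ _).inter ?_
    intro a ha b hb s t hs ht hst
    simp only [mem_ofPred_eq] at *
    rw [inner_add_left, real_inner_smul_left, real_inner_smul_left]
    calc m = s * m + t * m := by rw [← add_mul, hst, one_mul]
      _ ≤ _ := by gcongr
  have hsub : ∀ a ∈ closedBall x (r + M * δ), f a '' U ⊆ D := by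
    rintro a ha _ ⟨v, hv, rfl⟩
    refine ⟨by simpa using hbound a ha v hv, ?_⟩
    have h1 : inner ℝ (f x u) p ≤ inner ℝ (f x v) p := humin hv
    have h2 : inner ℝ (f x v) p - inner ℝ (f a v) p ≤ Kf * (r + M * δ) * r := by
      rw [← inner_sub_left]
      refine (real_inner_le_norm _ _).trans ?_
      rw [hpr]
      gcongr
      refine (hlipf x hxmem a ha v hv).trans ?_
      gcongr
      rw [norm_sub_rev, ← dist_eq_norm]
      exact ha
    simp only [mem_ofPred_eq]
    linarith
  have hball : closedBall z (M * δ) ⊆ closedBall x (r + M * δ) :=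
    closedBall_subset_closedBall' (by rw [mem_sphere.1 hz]; linarith)
  obtain ⟨θ, ⟨hθM, hθp⟩, hθL⟩ := exists_decrease_of_lowerDini_lt (z := z) (c := 7 / 8 * c) hL hDconv
    hDcl hM (fun θ hθ => by simpa using hθ.1) hδ.le (by
      intro a ha
      obtain ⟨V, hV, θ, hθ, h⟩ := hdecay a (hball ha)
      exact ⟨θ, closure_minimal (convexHull_min ((image_mono hV).trans (hsub a (hball ha))) hDconv)
        hDcl hθ, h⟩)
  rw [mem_closedBall_zero_iff] at hθM
  simp only [mem_ofPred_eq] at hθp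
  set y := z + δ • θ with hy
  have hymem : y ∈ closedBall x (r + M * δ) := by
    apply hball
    rw [mem_closedBall, dist_eq_norm, hy, add_sub_cancel_left, norm_smul,
      Real.norm_of_nonneg hδ.le, mul_comm]
    gcongr
  set F := f x u
  have hF : ‖F‖ ≤ M := hbound x hxmem u hu
  -- Chosen so that 2re equals the linear plus quadratic error in the expansion of ‖p + δ(F - θ)‖².
  set e := δ * Kf * (r + M * δ) + 2 * M ^ 2 * δ ^ 2 / r with he
  have he0 : 0 ≤ e := by positivity
  have hmain : ‖p + δ • (F - θ)‖ ≤ r + e := by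
    refine (pow_le_pow_iff_left₀ (norm_nonneg _) (by positivity) two_ne_zero).1 ?_
    rw [norm_add_sq_real, hpr, inner_smul_right, norm_smul, Real.norm_of_nonneg hδ.le,
      real_inner_comm, inner_sub_left]
    have h1 : ‖F - θ‖ ≤ 2 * M := (norm_sub_le _ _).trans (by linarith)
    have h2 : (δ * ‖F - θ‖) ^ 2 ≤ (δ * (2 * M)) ^ 2 := by gcongr
    have h3 : δ * (inner ℝ F p - inner ℝ θ p) ≤ δ * (Kf * (r + M * δ) * r) := by
      gcongr; linarith
    have h4 : 2 * r * e = 2 * (δ * (Kf * (r + M * δ) * r)) + (δ * (2 * M)) ^ 2 := by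
      rw [he]; field_simp
    nlinarith [sq_nonneg e]
  have hdist : ‖x' - y‖ ≤ r + (e + Kf * (M * δ) * δ) := by
    have : x' - y = (p + δ • (F - θ)) + (x' - x - δ • F) := by
      rw [hy, hp, smul_sub]; abel
    rw [this]
    exact (norm_add_le _ _).trans (by linarith)
  set E := e + Kf * (M * δ) * δ with hE
  have hE0 : 0 ≤ E := by positivity
  -- The budget: the Lipschitz errors take c/8 and the quadratic term c/2 of the rate 7c/8, which
  -- leaves c/4.
  have hKE : KL * E ≤ 5 / 8 * (c * δ) := by
    have h1 : KL * E = KL * Kf * (r + 2 * (M * δ)) * δ + 2 * KL * δ / r * (M ^ 2 * δ) := by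
      rw [hE, he]; field_simp; ring
    have h2 : 2 * KL * δ / r * (M ^ 2 * δ) ≤ 2 * KL * δ / r * (c * r / (4 * KL)) := by gcongr
    have h3 : 2 * KL * δ / r * (c * r / (4 * KL)) = c * δ / 2 := by field_simp; ring
    have h4 : KL * Kf * (r + 2 * (M * δ)) * δ ≤ c / 8 * δ := by gcongr
    linarith
  -- the point of the ball around `x'` on the segment towards `y`
  have hrE : 0 < r + E := by positivity
  set y' := x' + (r / (r + E)) • (y - x') with hy'
  have hy'x : ‖y' - x'‖ ≤ r := by
    rw [hy', add_sub_cancel_left, norm_smul, Real.norm_of_nonneg (by positivity), norm_sub_rev]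
    calc _ ≤ r / (r + E) * (r + E) := by gcongr
      _ = r := by field_simp
  have hy'y : ‖y' - y‖ ≤ E := by
    have : y' - y = (E / (r + E)) • (x' - y) := by
      have h1 : E / (r + E) = 1 - r / (r + E) := by field_simp; ring
      rw [h1, hy']
      module
    rw [this, norm_smul, Real.norm_of_nonneg (by positivity)]
    calc _ ≤ E / (r + E) * (r + E) := by gcongr
      _ = E := by field_simp
  have hy'mem : y' ∈ closedBall x (r + M * δ) := by
    rw [mem_closedBall, dist_eq_norm, ← sub_add_sub_cancel y' x' x]
    exact (norm_add_le _ _).trans (by linarith)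
  refine ⟨y', by rwa [mem_closedBall, dist_eq_norm], ?_⟩
  have h1 := (le_abs_self _).trans (hlipL y' hy'mem y hymem)
  have h2 : KL * ‖y' - y‖ ≤ KL * E := by gcongr
  linarith

/-! ### Solutions over one period and their concatenation. -/

section Pieces

variable {E : Type*} [NormedAddCommGroup E] [NormedSpace ℝ E] {g : E → E} {φ : ℝ → E} {δ M m K : ℝ}

theorem hasDerivWithinAt_Ici_of_Ico {v : E} {a b t : ℝ} (ht : t ∈ Ico a b)
    (h : HasDerivWithinAt φ v (Ico a b) t) : HasDerivWithinAt φ v (Ici t) t :=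
  h.mono_of_mem_nhdsWithin (mem_of_superset (Ico_mem_nhdsGE ht.2) (Ico_subset_Ico_left ht.1))

/-- A solution cannot travel faster than the bound of the vector field on the ball that it can
reach. -/
theorem norm_sub_le_of_bound_on_closedBall (hM : 0 ≤ M) (hmM : m < M)
    (hcont : ContinuousOn φ (Icc 0 δ))
    (hderiv : ∀ t ∈ Ico 0 δ, HasDerivWithinAt φ (g (φ t)) (Ico 0 δ) t)
    (hbound : ∀ a ∈ closedBall (φ 0) (M * δ), ‖g a‖ ≤ m) :
    ∀ t ∈ Icc 0 δ, ‖φ t - φ 0‖ ≤ M * t := by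
  intro t ht
  refine image_norm_le_of_norm_deriv_right_lt_deriv_boundary (f := fun t => φ t - φ 0)
    (f' := fun t => g (φ t)) (B := fun t => M * t) (B' := fun _ => M)
    (hcont.sub continuousOn_const) (fun s hs => ?_) (by simp) (fun s => ?_) ?_ ht
  · exact (hasDerivWithinAt_Ici_of_Ico hs (hderiv s hs)).sub_const _
  · simpa using (hasDerivAt_id s).const_mul M
  -- The field need only be bounded where the norm touches the barrier Mt, and such points lie in
  -- the ball. The barrier argument needs m < M strictly.
  · intro s hs heq
    refine (hbound _ ?_).trans_lt hmM
    rw [mem_closedBall, dist_eq_norm, heq]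
    exact mul_le_mul_of_nonneg_left hs.2.le hM

theorem norm_sub_euler_le (hδ : 0 ≤ δ) (hM : 0 ≤ M) (hK : 0 ≤ K) (hmM : m < M)
    (hcont : ContinuousOn φ (Icc 0 δ))
    (hderiv : ∀ t ∈ Ico 0 δ, HasDerivWithinAt φ (g (φ t)) (Ico 0 δ) t)
    (hbound : ∀ a ∈ closedBall (φ 0) (M * δ), ‖g a‖ ≤ m)
    (hlip : ∀ a ∈ closedBall (φ 0) (M * δ), ‖g a - g (φ 0)‖ ≤ K * ‖a - φ 0‖) :
    ‖φ δ - φ 0 - δ • g (φ 0)‖ ≤ K * (M * δ) * δ := by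
  have hd := norm_sub_le_of_bound_on_closedBall hM hmM hcont hderiv hbound
  have := norm_image_sub_le_of_norm_deriv_right_le_segment (f := fun t => φ t - t • g (φ 0))
    (f' := fun t => g (φ t) - (1 : ℝ) • g (φ 0)) (a := 0) (b := δ) (C := K * (M * δ))
    (hcont.sub (by fun_prop))
    (fun s hs => (hasDerivWithinAt_Ici_of_Ico hs (hderiv s hs)).sub
      ((hasDerivAt_id s).smul_const (g (φ 0))).hasDerivWithinAt)
    (fun s hs => by
      have h1 : ‖φ s - φ 0‖ ≤ M * δ :=
        (hd s (Ico_subset_Icc_self hs)).trans (mul_le_mul_of_nonneg_left hs.2.le hM)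
      rw [one_smul]
      refine (hlip _ (by rwa [mem_closedBall, dist_eq_norm])).trans ?_
      gcongr) δ (right_mem_Icc.2 hδ)
  simpa [sub_right_comm] using this

theorem exists_solution_of_bound_on_closedBall [CompleteSpace E] (x₀ : E) (hδ : 0 ≤ δ)
    (hM : 0 ≤ M) (hK : 0 ≤ K) (hbound : ∀ a ∈ closedBall x₀ (M * δ), ‖g a‖ ≤ M)
    (hlip : ∀ a ∈ closedBall x₀ (M * δ), ∀ b ∈ closedBall x₀ (M * δ),
      ‖g a - g b‖ ≤ K * ‖a - b‖) :
    ∃ φ : ℝ → E, φ 0 = x₀ ∧ ContinuousOn φ (Icc 0 δ) ∧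
      ∀ t ∈ Ico 0 δ, HasDerivWithinAt φ (g (φ t)) (Ico 0 δ) t := by
  have hMδ : 0 ≤ M * δ := mul_nonneg hM hδ
  have h : IsPicardLindelof (fun _ => g) (⟨0, left_mem_Icc.2 hδ⟩ : Icc 0 δ) x₀
      ⟨M * δ, hMδ⟩ 0 ⟨M, hM⟩ ⟨K, hK⟩ := by
    refine .of_time_independent hbound (LipschitzOnWith.of_dist_le_mul fun a ha b hb => ?_) ?_
    · rw [dist_eq_norm, dist_eq_norm]
      exact hlip a ha b hb
    · simp only [sub_zero, sub_self, max_eq_left hδ, NNReal.coe_zero]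
      exact le_rfl
  obtain ⟨φ, h0, hφ⟩ := h.exists_eq_forall_mem_Icc_hasDerivWithinAt₀
  exact ⟨φ, h0, fun t ht => (hφ t ht).continuousWithinAt,
    fun t ht => (hφ t (Ico_subset_Icc_self ht)).mono Ico_subset_Icc_self⟩

end Pieces

theorem IsSampleHoldTrajectory.shift {n : ℕ} {C : Type*} {f : State n → C → State n}
    {κ : State n → C} {δ : ℝ} {x₀ : State n} {x : ℝ → State n} (hδ : 0 ≤ δ)
    (h : IsSampleHoldTrajectory f κ δ x₀ x) (k : ℕ) :
    ContinuousOn (fun t => x (k * δ + t)) (Icc 0 δ) ∧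
      ∀ t ∈ Ico 0 δ, HasDerivWithinAt (fun t => x (k * δ + t))
        (f (x (k * δ + t)) (κ (x (k * δ)))) (Ico 0 δ) t := by
  refine ⟨h.continuousOn.comp (by fun_prop) fun t ht => ?_, fun t ht => ?_⟩
  · exact add_nonneg (by positivity) ht.1
  · have hmaps : MapsTo (fun t => k * δ + t) (Ico 0 δ) (Ico (k * δ) ((k + 1) * δ)) :=
      fun s hs => ⟨by linarith [hs.1], by linarith [hs.2]⟩
    have := (h.deriv k _ (hmaps ht)).scomp t
      ((hasDerivAt_id t).const_add (k * δ)).hasDerivWithinAt hmaps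
    rwa [one_smul] at this

/-- Solutions over single sampling periods concatenate to a trajectory of the sampled system. -/
theorem exists_isSampleHoldTrajectory {n : ℕ} {C : Type*} {f : State n → C → State n}
    {κ : State n → C} {δ : ℝ} (hδ : 0 < δ) {G : Set (State n)}
    (hstep : ∀ x ∈ G, ∃ φ : ℝ → State n, φ 0 = x ∧ ContinuousOn φ (Icc 0 δ) ∧
      (∀ t ∈ Ico 0 δ, HasDerivWithinAt φ (f (φ t) (κ x)) (Ico 0 δ) t) ∧ φ δ ∈ G)
    {x₀ : State n} (hx₀ : x₀ ∈ G) : ∃ x, IsSampleHoldTrajectory f κ δ x₀ x := by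
  choose! Φ h0 hcont hderiv hG using hstep
  let a : ℕ → State n := fun k => Nat.rec x₀ (fun _ y => Φ y δ) k
  have haG : ∀ k, a k ∈ G := fun k => by
    induction k with
    | zero => exact hx₀
    | succ k ih => exact hG _ ih
  let x : ℝ → State n := fun t => Φ (a ⌊t / δ⌋₊) (t - ⌊t / δ⌋₊ * δ)
  have hIco : ∀ k : ℕ, ∀ t ∈ Ico (k * δ) ((k + 1) * δ), x t = Φ (a k) (t - k * δ) := by
    intro k t ht
    have : ⌊t / δ⌋₊ = k := by
      rw [Nat.floor_eq_iff (div_nonneg (le_trans (by positivity) ht.1) hδ.le)]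
      exact ⟨(le_div_iff₀ hδ).2 ht.1, (div_lt_iff₀ hδ).2 ht.2⟩
    simp only [x, this]
  have hnode : ∀ k : ℕ, x (k * δ) = a k := fun k => by
    rw [hIco k _ ⟨le_rfl, by linarith⟩, sub_self, h0 _ (haG k)]
  -- At the right endpoint the floor has already jumped to k + 1; the pieces agree there because the
  -- next one starts at the end of the last.
  have hIcc : ∀ k : ℕ, ∀ t ∈ Icc (k * δ) ((k + 1) * δ), x t = Φ (a k) (t - k * δ) := by
    intro k t ht
    rcases ht.2.eq_or_lt with rfl | hlt
    · have := hnode (k + 1)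
      push_cast at this
      rw [this]
      have h1 : ((k : ℝ) + 1) * δ - k * δ = δ := by ring
      rw [h1]
    · exact hIco k t ⟨ht.1, hlt⟩
  have hcontk : ∀ k : ℕ, ContinuousOn x (Icc (k * δ) ((k + 1) * δ)) := fun k =>
    ((hcont _ (haG k)).comp (f := fun t => t - k * δ) (by fun_prop)
      fun t ht => ⟨by linarith [ht.1], by linarith [ht.2]⟩).congr (hIcc k)
  have hcont0 : ∀ k : ℕ, ContinuousOn x (Icc 0 (k * δ)) := by
    intro k
    induction k with
    | zero => simp
    | succ k ih =>
      have := ih.union_of_isClosed (hcontk k) isClosed_Icc isClosed_Icc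
      rw [Icc_union_Icc_eq_Icc (by positivity) (by linarith)] at this
      exact_mod_cast this
  refine ⟨x, ?_, ?_, ?_⟩
  · have := hnode 0
    rwa [Nat.cast_zero, zero_mul] at this
  · intro t ht
    obtain ⟨k, hk⟩ := exists_nat_gt (t / δ)
    rw [div_lt_iff₀ hδ] at hk
    refine (hcont0 k t ⟨ht, hk.le⟩).mono_of_mem_nhdsWithin ?_
    rw [← Ici_inter_Iic]
    exact inter_mem_nhdsWithin _ (Iic_mem_nhds hk)
  · intro k t ht
    have hmaps : MapsTo (fun t => t - k * δ) (Ico (k * δ) ((k + 1) * δ)) (Ico 0 δ) :=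
      fun s hs => ⟨by linarith [hs.1], by linarith [hs.2]⟩
    rw [hnode k, hIco k t ht]
    have := (hderiv _ (haG k) _ (hmaps ht)).scomp t
      ((hasDerivAt_id t).sub_const (k * δ)).hasDerivWithinAt hmaps
    rw [one_smul] at this
    exact this.congr (hIco k) (hIco k t ht)

/-! ### Decrease over one sampling period. -/

section Period

variable {n : ℕ} {C : Type*} [TopologicalSpace C] {f : State n → C → State n} {U : Set C}
  {L w : State n → ℝ} {α₁ α₂ : ℝ → ℝ} {ρ R KL Kf Mf c : ℝ}

/-- The infimum over directions need not be attained; the slack b < c yields an actual direction. -/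
theorem IsCLF.exists_lowerDini_lt (hL : IsCLF f U L w α₁ α₂)
    (hc : AreConstantsOn f U L w ρ R KL Kf Mf c) {b : ℝ} (hb : b < c) {y : State n}
    (hy : y ∈ closedBall 0 R) (hρ : ρ ≤ ‖y‖) :
    ∃ V ⊆ U, ∃ θ ∈ closure (convexHull ℝ (f y '' V)), lowerDini L y θ < ((-b : ℝ) : EReal) := by
  obtain ⟨V, hV, -, h⟩ := hL.decay _ (isCompact_closedBall (0 : State n) R)
  refine ⟨V, hV, ?_⟩
  have hw : c ≤ w y := hc.decay_le y hρ (by simpa using hy)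
  have hlt : (⨅ θ ∈ closure (convexHull ℝ (f y '' V)), lowerDini L y θ) < ((-b : ℝ) : EReal) :=
    (h y hy).trans_lt (by exact_mod_cast (by linarith : -w y < -b))
  simpa [iInf_lt_iff] using hlt

variable {r δ ε Q Λ ℓ : ℝ}

/-- Keeps everything met during a period where the constants are valid: the margin 3ε pays for r
from z to x and for the radius r + Mδ. -/
theorem closedBall_subset_of_exists_le {x : State n} {M b : ℝ} (hQ : ∀ z, L z ≤ Λ → ‖z‖ ≤ Q)
    (hεR : Q + 3 * ε ≤ R) (hrε : r ≤ ε) (hMδ : M * δ ≤ ε) (hb : b ≤ Λ)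
    (hx : ∃ z ∈ closedBall x r, L z ≤ b) :
    closedBall x (r + M * δ) ⊆ closedBall 0 R := by
  obtain ⟨z, hz, hzb⟩ := hx
  apply closedBall_subset_closedBall'
  have h1 := hQ z (hzb.trans hb)
  have h2 : dist x 0 ≤ dist z x + ‖z‖ := by
    rw [← dist_zero_right z, dist_comm z x]; exact dist_triangle _ _ _
  rw [mem_closedBall] at hz
  linarith

/-- Over one sampling period, the least value of `L` on the ball of the aiming radius around the
state falls by `c δ / 4`, unless it is already small at the end of the period. -/
theorem IsDiniAiming.exists_mem_closedBall_le (hL : IsCLF f U L w α₁ α₂)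
    (hc : AreConstantsOn f U L w ρ R KL Kf Mf c) (hQ : ∀ z, L z ≤ Λ → ‖z‖ ≤ Q)
    (hcore : ∀ y, ℓ / 4 ≤ L y → ρ ≤ ‖y‖) (hεR : Q + 3 * ε ≤ R) (hεℓ : 16 * KL * ε ≤ ℓ)
    (hεc : 24 * KL * Kf * ε ≤ c) (hr : 0 < r) (hrε : r ≤ ε) (hδ : 0 < δ)
    (hMδ : (Mf + c / (2 * KL)) * δ ≤ ε)
    (hsmall : (Mf + c / (2 * KL)) ^ 2 * δ ≤ c * r / (4 * KL))
    {κ : State n → C} (hκ : IsDiniAiming f U L r κ) {φ : ℝ → State n}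
    (hcont : ContinuousOn φ (Icc 0 δ))
    (hderiv : ∀ t ∈ Ico 0 δ, HasDerivWithinAt φ (f (φ t) (κ (φ 0))) (Ico 0 δ) t)
    {b : ℝ} (hb : b ≤ Λ) (hφ : ∃ z ∈ closedBall (φ 0) r, L z ≤ b) :
    (∀ t ∈ Icc 0 δ, ‖φ t - φ 0‖ ≤ (Mf + c / (2 * KL)) * t) ∧
      ∃ z ∈ closedBall (φ δ) r, L z ≤ max (ℓ / 2) (b - c * δ / 4) := by
  have hKL := hc.KL_pos
  have hKf := hc.Kf_pos
  have hc0 := hc.c_pos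
  set M := Mf + c / (2 * KL) with hM
  have hMfM : Mf < M := by rw [hM]; linarith [show 0 < c / (2 * KL) by positivity]
  have hR := closedBall_subset_of_exists_le hQ hεR hrε hMδ hb hφ
  obtain ⟨z, hz, hzmin, hu, humin⟩ := hκ (φ 0)
  -- The sign of `Mf` comes from evaluating its bound at one point, so `φ 0` is placed in the ball
  -- of radius R without using `hR`, whose ball could be empty for negative M.
  have hM0 : 0 ≤ M := by
    by_contra! hneg
    obtain ⟨v, hv, hvb⟩ := hφ
    have h0 : φ 0 ∈ closedBall (0 : State n) R := by
      have h1 := hQ v (hvb.trans hb)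
      have h2 : dist (φ 0) 0 ≤ dist v (φ 0) + ‖v‖ := by
        rw [← dist_zero_right v, dist_comm v]; exact dist_triangle _ _ _
      rw [mem_closedBall] at hv ⊢
      linarith
    linarith [norm_nonneg (f (φ 0) (κ (φ 0))), hc.bound_f _ h0 _ hu]
  have hMδ0 : 0 ≤ M * δ := by positivity
  have hMsub : closedBall (φ 0) (M * δ) ⊆ closedBall (φ 0) (r + M * δ) :=
    closedBall_subset_closedBall (by linarith)
  have h0mem : φ 0 ∈ closedBall (φ 0) (r + M * δ) := mem_closedBall_self (by positivity)
  have hspeed := norm_sub_le_of_bound_on_closedBall (g := fun a => f a (κ (φ 0))) hM0 hMfM hcont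
    hderiv fun a ha => hc.bound_f a (hR (hMsub ha)) _ hu
  refine ⟨hspeed, ?_⟩
  have hδspeed := hspeed δ (right_mem_Icc.2 hδ.le)
  have hlipL : ∀ a ∈ closedBall (φ 0) (r + M * δ), ∀ b ∈ closedBall (φ 0) (r + M * δ),
      |L a - L b| ≤ KL * ‖a - b‖ := fun a ha b hb => hc.lipschitz_L a (hR ha) b (hR hb)
  -- Since KL·ε ≤ ℓ/16, below 3ℓ/8 a period ends below 7ℓ/16. Above it, `L` is at least ℓ/4 within
  -- distance 2ε, so decay holds there.
  rcases lt_or_ge (L (φ 0)) (3 / 8 * ℓ) with hlt | hge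
  · refine ⟨φ δ, mem_closedBall_self hr.le, le_max_of_le_left ?_⟩
    have h1 := (le_abs_self _).trans (hlipL (φ δ)
      (hMsub (by rwa [mem_closedBall, dist_eq_norm])) (φ 0) h0mem)
    have h2 : KL * ‖φ δ - φ 0‖ ≤ KL * ε := by gcongr; exact hδspeed.trans hMδ
    linarith [mul_pos hKL (hr.trans_le hrε)]
  · have hfar : ∀ y ∈ closedBall (φ 0) (r + M * δ), ρ ≤ ‖y‖ := by
      intro y hy
      have h1 := (neg_le_abs _).trans (hlipL y hy (φ 0) h0mem)
      have h2 : KL * ‖y - φ 0‖ ≤ KL * (2 * ε) := by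
        gcongr
        rw [← dist_eq_norm]
        exact (mem_closedBall.1 hy).trans (by linarith)
      exact hcore y (by linarith)
    have hdecay : ∀ y ∈ closedBall (φ 0) (r + M * δ), ∃ V ⊆ U,
        ∃ θ ∈ closure (convexHull ℝ (f y '' V)),
          lowerDini L y θ < ((-(7 / 8 * c) : ℝ) : EReal) := fun y hy =>
      hL.exists_lowerDini_lt hc (by linarith) (hR hy) (hfar y hy)
    have hcontL := hL.locallyLipschitz.continuous
    have hzball := isMinOn_closedBall_of_isMinOn_sphere hcontL hr.le hzmin fun y hy _ => by
      obtain ⟨V, -, θ, -, h⟩ := hdecay y (closedBall_subset_closedBall (by linarith) hy)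
      refine ⟨θ, h.trans_le ?_⟩
      exact_mod_cast (by linarith : -(7 / 8 * c) ≤ 0)
    obtain ⟨v, hv, hvb⟩ := hφ
    have hzb : L z ≤ b := le_trans (hzball hv) hvb
    have hEuler := norm_sub_euler_le (g := fun a => f a (κ (φ 0))) hδ.le hM0 hKf.le hMfM hcont
      hderiv (fun a ha => hc.bound_f a (hR (hMsub ha)) _ hu)
      fun a ha => hc.lipschitz_f a (hR (hMsub ha)) _ (hR h0mem) _ hu
    obtain ⟨y, hy, hyL⟩ := exists_mem_closedBall_le_of_aiming hcontL hr hδ hM0 hKL hKf hlipL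
      (fun a ha b hb v hv => hc.lipschitz_f a (hR ha) b (hR hb) v hv)
      (fun a ha v hv => (hc.bound_f a (hR ha) v hv).trans hMfM.le) hdecay hz hu humin hδspeed
      hEuler hsmall (by
        have : KL * Kf * (r + 2 * (M * δ)) ≤ KL * Kf * (3 * ε) := by gcongr; linarith
        linarith)
    exact ⟨y, hy, le_max_of_le_right (by linarith)⟩

end Period

/-! ### Bounds drawn from the period and from the comparison functions. -/

theorem sq_mul_le_of_le_periodBound {r KL Kf Mf c T₁ l₁ l₂ ε₃ δ : ℝ} (hKL : 0 < KL) (hKf : 0 < Kf)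
    (hc : 0 < c) (hMf : 0 ≤ Mf) (hr : 0 < r) (hδ : 0 < δ)
    (h : δ ≤ periodBound r KL Kf Mf c T₁ l₁ l₂ ε₃) :
    (Mf + c / (2 * KL)) * δ ≤ ε₃ ∧ (Mf + c / (2 * KL)) ^ 2 * δ ≤ c * r / (4 * KL) := by
  simp only [periodBound, le_min_iff] at h
  obtain ⟨-, h3, h4⟩ := h
  have hM : 0 < Mf + c / (2 * KL) := by positivity
  set M := Mf + c / (2 * KL)
  refine ⟨by rwa [le_div_iff₀ hM, mul_comm] at h3, ?_⟩
  set a₁ := M ^ 2 * KL with ha₁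
  set a₂ := M * (M + r * Kf) with ha₂
  set a₃ := c * r / (4 * KL)
  have h₁ : 0 < a₁ := by positivity
  have h₂ : 0 < a₂ := by positivity
  -- The last entry of the minimum is the positive root of a₁δ² + a₂δ = a₃.
  rw [le_div_iff₀ (by positivity), le_sub_iff_add_le, Real.le_sqrt' (by positivity)] at h4
  have h5 : a₁ * δ ^ 2 + a₂ * δ ≤ a₃ := by nlinarith
  have h6 : M ^ 2 * δ ≤ a₂ * δ := by
    rw [ha₂]; nlinarith [show 0 < M * (r * Kf) * δ by positivity]
  have h7 : 0 ≤ a₁ * δ ^ 2 := by positivity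
  linarith

theorem Continuous.le_maxOnBall {n : ℕ} {L : State n → ℝ} (hL : Continuous L) {S : ℝ}
    {x : State n} (hx : x ∈ closedBall 0 S) : L x ≤ maxOnBall L S :=
  le_csSup ((isCompact_closedBall _ _).image hL).bddAbove (mem_image_of_mem _ hx)

theorem Continuous.maxOnBall_mono {n : ℕ} {L : State n → ℝ} (hL : Continuous L) {S S' : ℝ}
    (hS : 0 ≤ S) (h : S ≤ S') : maxOnBall L S ≤ maxOnBall L S' :=
  csSup_le_csSup ((isCompact_closedBall _ _).image hL).bddAbove
    ((nonempty_closedBall.2 hS).image _) (image_mono (closedBall_subset_closedBall h))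

section CLF

variable {n : ℕ} {C : Type*} [TopologicalSpace C] {f : State n → C → State n} {U : Set C}
  {L w : State n → ℝ} {α₁ α₂ : ℝ → ℝ} {S s : ℝ}

theorem IsCLF.maxOnBall_nonneg (hL : IsCLF f U L w α₁ α₂) (hS : 0 ≤ S) : 0 ≤ maxOnBall L S := by
  simpa [hL.map_zero] using hL.locallyLipschitz.continuous.le_maxOnBall (mem_closedBall_self hS)

theorem IsCLF.norm_le_overshootRadius (hL : IsCLF f U L w α₁ α₂) (hS : 0 ≤ S) {z : State n}
    (hz : L z ≤ maxOnBall L S) : ‖z‖ ≤ overshootRadius L α₁ S := by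
  have h0 := hL.maxOnBall_nonneg hS
  refine hL.lower_kInfty.le_of_map_le (norm_nonneg _) (hL.lower_kInfty.kInv_nonneg h0) ?_
  rw [overshootRadius, hL.lower_kInfty.map_kInv h0]
  exact (hL.lower_bound z).trans hz

theorem IsCLF.coreRadius_le_norm (hL : IsCLF f U L w α₁ α₂) (hs : 0 ≤ α₁ s) {y : State n}
    (hy : α₁ s / 4 ≤ L y) : coreRadius α₁ α₂ s ≤ ‖y‖ := by
  have h0 : 0 ≤ α₁ s / 4 := by positivity
  refine hL.upper_kInfty.le_of_map_le (hL.upper_kInfty.kInv_nonneg h0) (norm_nonneg _) ?_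
  rw [coreRadius, hL.upper_kInfty.map_kInv h0]
  exact hy.trans (hL.upper_bound y)

theorem IsCLF.map_le_maxOnBall [Nontrivial (State n)] (hL : IsCLF f U L w α₁ α₂) (hS : 0 ≤ S) :
    α₁ S ≤ maxOnBall L S := by
  obtain ⟨v, hv⟩ := exists_norm_eq (State n) hS
  rw [← hv]
  exact (hL.lower_bound v).trans (hL.locallyLipschitz.continuous.le_maxOnBall (by simp))

theorem IsCLF.le_overshootRadius [Nontrivial (State n)] (hL : IsCLF f U L w α₁ α₂) (hS : 0 ≤ S) :
    S ≤ overshootRadius L α₁ S := by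
  have h0 := hL.maxOnBall_nonneg hS
  refine hL.lower_kInfty.le_of_map_le hS (hL.lower_kInfty.kInv_nonneg h0) ?_
  rw [overshootRadius, hL.lower_kInfty.map_kInv h0]
  exact hL.map_le_maxOnBall hS

end CLF

/-! ### Iteration over the sampling periods. -/

section Stabilization

variable {n : ℕ} {C : Type*} [TopologicalSpace C] {f : State n → C → State n} {U : Set C}
  {L w : State n → ℝ} {α₁ α₂ : ℝ → ℝ} {ρ R KL Kf Mf c r δ ε Q Λ ℓ : ℝ} {κ : State n → C}

/-- Each sampled trajectory of a Dini-aiming feedback stays in a ball, and the upper estimate of `L`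
along it decreases linearly until it is below `ℓ / 2`. -/
theorem IsDiniAiming.trajectory_estimate (hL : IsCLF f U L w α₁ α₂)
    (hc : AreConstantsOn f U L w ρ R KL Kf Mf c) (hQ : ∀ z, L z ≤ Λ → ‖z‖ ≤ Q)
    (hcore : ∀ y, ℓ / 4 ≤ L y → ρ ≤ ‖y‖) (hℓΛ : ℓ / 2 ≤ Λ) (hεR : Q + 3 * ε ≤ R)
    (hεℓ : 16 * KL * ε ≤ ℓ) (hεc : 24 * KL * Kf * ε ≤ c) (hr : 0 < r) (hrε : r ≤ ε) (hδ : 0 < δ)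
    (hMf : 0 ≤ Mf) (hMδ : (Mf + c / (2 * KL)) * δ ≤ ε)
    (hsmall : (Mf + c / (2 * KL)) ^ 2 * δ ≤ c * r / (4 * KL))
    (hκ : IsDiniAiming f U L r κ) {x₀ : State n} (hx₀ : L x₀ ≤ Λ) {x : ℝ → State n}
    (hx : IsSampleHoldTrajectory f κ δ x₀ x) {k : ℕ} {t : ℝ}
    (ht : t ∈ Icc (k * δ) ((k + 1) * δ)) :
    x t ∈ closedBall 0 R ∧ L (x t) ≤ max (ℓ / 2) (Λ - k * δ * c / 4) + KL * (2 * ε) := by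
  have hKL := hc.KL_pos
  have hc0 := hc.c_pos
  have hmax : ∀ k : ℕ, max (ℓ / 2) (Λ - k * δ * c / 4) ≤ Λ := fun k =>
    max_le hℓΛ (by linarith [show 0 ≤ k * δ * c / 4 by positivity])
  have hper : ∀ (k : ℕ) (b : ℝ), b ≤ Λ → (∃ z ∈ closedBall (x (k * δ)) r, L z ≤ b) →
      (∀ t ∈ Icc 0 δ, ‖x (k * δ + t) - x (k * δ)‖ ≤ (Mf + c / (2 * KL)) * t) ∧
        ∃ z ∈ closedBall (x (k * δ + δ)) r, L z ≤ max (ℓ / 2) (b - c * δ / 4) := by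
    intro k b hb hz
    obtain ⟨h1, h2⟩ := hx.shift hδ.le k
    simpa only [add_zero] using hκ.exists_mem_closedBall_le (φ := fun t => x (k * δ + t)) hL hc hQ
      hcore hεR hεℓ hεc hr hrε hδ hMδ hsmall h1 (by simpa only [add_zero] using h2) hb
      (by simpa only [add_zero] using hz)
  have hinv : ∀ k : ℕ, ∃ z ∈ closedBall (x (k * δ)) r, L z ≤ max (ℓ / 2) (Λ - k * δ * c / 4) := by
    intro k
    induction k with
    | zero =>
      refine ⟨x₀, ?_, ?_⟩
      · simp [hx.init, hr.le]
      · simp [hx₀]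
    | succ k ih =>
      obtain ⟨z, hz, hzb⟩ := (hper k _ (hmax k) ih).2
      have h1 : ((k + 1 : ℕ) : ℝ) * δ = k * δ + δ := by push_cast; ring
      refine ⟨z, by rwa [h1], hzb.trans (max_le (le_max_left _ _) ?_)⟩
      rcases le_total (ℓ / 2) (Λ - k * δ * c / 4) with h | h
      · rw [max_eq_right h]
        refine le_max_of_le_right ?_
        rw [h1]; linarith
      · rw [max_eq_left h]
        exact le_max_of_le_left (by linarith [show 0 < c * δ / 4 by positivity])
  have hspeed := (hper k _ (hmax k) (hinv k)).1 (t - k * δ) ⟨by linarith [ht.1], by linarith [ht.2]⟩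
  rw [add_sub_cancel] at hspeed
  have hMt : (Mf + c / (2 * KL)) * (t - k * δ) ≤ (Mf + c / (2 * KL)) * δ := by
    gcongr
    linarith [ht.2]
  have hR := closedBall_subset_of_exists_le hQ hεR hrε hMδ (hmax k) (hinv k)
  have hMδ0 : 0 ≤ (Mf + c / (2 * KL)) * δ := by positivity
  have hxR : x t ∈ closedBall 0 R := hR (by rw [mem_closedBall, dist_eq_norm]; linarith)
  refine ⟨hxR, ?_⟩
  obtain ⟨z, hz, hzb⟩ := hinv k
  have h1 := (le_abs_self _).trans (hc.lipschitz_L _ hxR z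
    (hR (closedBall_subset_closedBall (by linarith) hz)))
  have h2 : KL * ‖x t - z‖ ≤ KL * (2 * ε) := by
    gcongr
    rw [mem_closedBall, dist_comm, dist_eq_norm] at hz
    rw [← sub_add_sub_cancel (x t) (x (k * δ)) z]
    exact (norm_add_le _ _).trans (by linarith)
  linarith

/-- States within r of the sublevel set of level `Λ` are carried to such states by each period, so
local solutions can be continued forever. -/
theorem IsDiniAiming.exists_trajectory (hL : IsCLF f U L w α₁ α₂)
    (hc : AreConstantsOn f U L w ρ R KL Kf Mf c) (hQ : ∀ z, L z ≤ Λ → ‖z‖ ≤ Q)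
    (hcore : ∀ y, ℓ / 4 ≤ L y → ρ ≤ ‖y‖) (hℓΛ : ℓ / 2 ≤ Λ) (hεR : Q + 3 * ε ≤ R)
    (hεℓ : 16 * KL * ε ≤ ℓ) (hεc : 24 * KL * Kf * ε ≤ c) (hr : 0 < r) (hrε : r ≤ ε) (hδ : 0 < δ)
    (hMf : 0 ≤ Mf) (hMδ : (Mf + c / (2 * KL)) * δ ≤ ε)
    (hsmall : (Mf + c / (2 * KL)) ^ 2 * δ ≤ c * r / (4 * KL))
    (hκ : IsDiniAiming f U L r κ) {x₀ : State n} (hx₀ : L x₀ ≤ Λ) :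
    ∃ x, IsSampleHoldTrajectory f κ δ x₀ x := by
  have hKL := hc.KL_pos
  have hc0 := hc.c_pos
  refine exists_isSampleHoldTrajectory hδ (G := {x | ∃ z ∈ closedBall x r, L z ≤ Λ}) ?_
    ⟨x₀, mem_closedBall_self hr.le, hx₀⟩
  intro x hx
  have hu : κ x ∈ U := by
    obtain ⟨-, -, -, hu, -⟩ := hκ x
    exact hu
  have hR := (closedBall_subset_closedBall (le_add_of_nonneg_left hr.le)).trans
    (closedBall_subset_of_exists_le hQ hεR hrε hMδ le_rfl hx)
  have hM : Mf ≤ Mf + c / (2 * KL) := by linarith [show 0 < c / (2 * KL) by positivity]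
  obtain ⟨φ, rfl, hcont, hderiv⟩ := exists_solution_of_bound_on_closedBall (g := fun a => f a (κ x))
    x hδ.le (hMf.trans hM) hc.Kf_pos.le (fun a ha => (hc.bound_f a (hR ha) _ hu).trans hM)
    fun a ha b hb => hc.lipschitz_f a (hR ha) b (hR hb) _ hu
  obtain ⟨-, z, hz, hzL⟩ := hκ.exists_mem_closedBall_le hL hc hQ hcore hεR hεℓ hεc hr hrε hδ hMδ
    hsmall hcont hderiv le_rfl hx
  refine ⟨φ, rfl, hcont, hderiv, z, hz, hzL.trans (max_le hℓΛ ?_)⟩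
  linarith [show 0 < c * δ / 4 by positivity]

end Stabilization

theorem theorem1 {n : ℕ} {C : Type*} [TopologicalSpace C]
    (f : State n → C → State n) (U : Set C) (hU : IsCompact U)
    (hf : LipschitzInState f U)
    (L w : State n → ℝ) (α₁ α₂ : ℝ → ℝ) (hL : IsCLF f U L w α₁ α₂)
    (S s : ℝ) (hs : 0 < s) (hsS : s < S)
    (R : ℝ) (hR : overshootRadius L α₁ S < R)
    (KL Kf Mf c : ℝ) (hc : AreConstantsOn f U L w (coreRadius α₁ α₂ s / 2) R KL Kf Mf c) :
    ∃ ε₂ ε₃ ε₄ l₁ l₂ : ℝ, 0 < ε₂ ∧ 0 < ε₃ ∧ 0 < ε₄ ∧ 0 < l₁ ∧ l₁ < l₂ ∧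
      ∀ r : ℝ, 0 < r → r ≤ radiusBound KL Kf c ε₂ ε₃ ε₄ →
      ∀ T₁ : ℝ, IsAdmissibleTime r KL c T₁ →
      ∀ δ : ℝ, 0 < δ → δ ≤ periodBound r KL Kf Mf c T₁ l₁ l₂ ε₃ →
      ∀ κ : State n → C, IsDiniAiming f U L r κ →
        SteersBallToBall f κ δ S s R (reachingTime L α₁ s S c δ) := by
  have hKL := hc.KL_pos
  have hKf := hc.Kf_pos
  have hc0 := hc.c_pos
  have hS : 0 < S := hs.trans hsS
  have hℓ : 0 < α₁ s := hL.lower_kInfty.pos hs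
  have hLc := hL.locallyLipschitz.continuous
  set Λ := maxOnBall L S
  set Q := overshootRadius L α₁ S with hQdef
  have hQ : ∀ z, L z ≤ Λ → ‖z‖ ≤ Q := fun z hz => hL.norm_le_overshootRadius hS.le hz
  have hcore : ∀ y, α₁ s / 4 ≤ L y → coreRadius α₁ α₂ s / 2 ≤ ‖y‖ := fun y hy => by
    linarith [hL.coreRadius_le_norm hℓ.le hy, norm_nonneg y]
  -- The three entries keep the motion in the ball of radius R, keep the oscillation of `L` small
  -- against ℓ, and keep the Lipschitz errors of `f` below c/8.
  set ε := min ((R - Q) / 3) (min (α₁ s / (16 * KL)) (c / (24 * KL * Kf))) with hε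
  have hε0 : 0 < ε := lt_min (by linarith) (lt_min (by positivity) (by positivity))
  have hεR : Q + 3 * ε ≤ R := by linarith [min_le_left _ _ |>.trans_eq' hε]
  have hεℓ : 16 * KL * ε ≤ α₁ s := by
    rw [mul_comm, ← le_div_iff₀ (by positivity)]
    exact (min_le_right _ _).trans (min_le_left _ _)
  have hεc : 24 * KL * Kf * ε ≤ c := by
    rw [mul_comm, ← le_div_iff₀ (by positivity)]
    exact (min_le_right _ _).trans (min_le_right _ _)
  -- All the smallness needed enters through ε₃ = ε; the other four values are arbitrary choices.
  refine ⟨1, ε, 1, 1, 2, one_pos, hε0, one_pos, one_pos, one_lt_two, ?_⟩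
  intro r hr hrb T₁ _ δ hδ hδb κ hκ x₀ hx₀
  have hrε : r ≤ ε := hrb.trans ((min_le_left _ _).trans (min_le_right _ _))
  obtain ⟨v, hv, -, hu, -⟩ := hκ 0
  -- In dimension zero spheres of positive radius are empty, so no aiming feedback exists.
  have : Nontrivial (State n) := ⟨v, 0, by
    rintro rfl
    simp [hr.ne] at hv⟩
  have hQ0 : S ≤ Q := hL.le_overshootRadius hS.le
  have hMf : 0 ≤ Mf :=
    (norm_nonneg _).trans (hc.bound_f 0 (mem_closedBall_self (by linarith)) _ hu)
  obtain ⟨hMδ, hsmall⟩ := sq_mul_le_of_le_periodBound hKL hKf hc0 hMf hr hδ hδb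
  have hℓΛ : α₁ s ≤ Λ := (hL.lower_kInfty.strictMonoOn hs.le hS.le hsS).le.trans
    (hL.map_le_maxOnBall hS.le)
  have hΛ : Λ ≤ maxOnBall L Q := hLc.maxOnBall_mono hS.le hQ0
  have hx₀Λ : L x₀ ≤ Λ := hLc.le_maxOnBall hx₀
  refine ⟨hκ.exists_trajectory hL hc hQ hcore (by linarith) hεR hεℓ hεc hr hrε hδ hMf hMδ hsmall
    hx₀Λ, fun x hx => ?_⟩
  have hest : ∀ t, 0 ≤ t → x t ∈ closedBall 0 R ∧ ∃ k : ℕ, t < (k + 1) * δ ∧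
      L (x t) ≤ max (α₁ s / 2) (Λ - k * δ * c / 4) + KL * (2 * ε) := by
    intro t ht
    have h1 : ⌊t / δ⌋₊ * δ ≤ t := (le_div_iff₀ hδ).1 (Nat.floor_le (by positivity))
    have h2 : t < (⌊t / δ⌋₊ + 1) * δ := (div_lt_iff₀ hδ).1 (Nat.lt_floor_add_one _)
    obtain ⟨h3, h4⟩ := hκ.trajectory_estimate hL hc hQ hcore (by linarith) hεR hεℓ hεc hr hrε hδ
      hMf hMδ hsmall hx₀Λ hx ⟨h1, h2.le⟩
    exact ⟨h3, _, h2, h4⟩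
  refine ⟨fun t ht => (hest t ht).1, fun t ht => ?_⟩
  have hT : reachingTime L α₁ s S c δ = 4 * (maxOnBall L Q - α₁ s / 2) / c := by
    rw [reachingTime, ← hQdef]; field_simp
  rw [hT, div_le_iff₀ hc0] at ht
  have ht0 : 0 ≤ t := by
    by_contra! hneg
    linarith [mul_neg_of_neg_of_pos hneg hc0]
  obtain ⟨-, k, hk, hLk⟩ := hest t ht0
  have h1 : t * c < (k + 1) * δ * c := by gcongr
  -- At time t only k > t/δ - 1 periods are complete. The missing one costs at most cδ/4 ≤ KL·ε/2,
  -- because c/(2·KL) is a summand of the speed M and Mδ ≤ ε. In total L(x(t)) ≤ ℓ/2 + 5·KL·ε/2 < ℓ.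
  have h2 : c * δ ≤ 2 * KL * ε := by
    have h3 : c / (2 * KL) * δ ≤ ε := by
      refine le_trans ?_ hMδ
      gcongr
      linarith
    rw [div_mul_eq_mul_div, div_le_iff₀ (by positivity)] at h3
    linarith
  have h3 : max (α₁ s / 2) (Λ - k * δ * c / 4) ≤ α₁ s / 2 + KL * ε / 2 :=
    max_le (by linarith [mul_pos hKL hε0]) (by linarith)
  rw [mem_closedBall_zero_iff]
  refine hL.lower_kInfty.le_of_map_le (norm_nonneg _) hs.le ((hL.lower_bound _).trans ?_)
  linarith [mul_pos hKL hε0]
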